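/- All spaces are Tychonoff (Hausdorff and completely regular). For a space $Z$ let $C_p(Z)$ denote the real vector space of all continuous functions $Z\to\mathbb R$ with the topology of pointwise convergence, and let $C_p^*(Z)$ denote its subspace of bounded continuous functions, with the same topology. A map is perfect if it is continuous and closed with compact fibres (it need not be onto). Let $X$ be a metrizable space and let $Y$ be a perfectly normal space. Suppose that there is a linear continuous surjection $T\colon C_p(X)\to C_p(Y)$ or a linear continuous surjection $T\colon C_p^*(X)\to C_p^*(Y)$. Let $\mathcal P$ be a topological property (that is, a property of spaces invariant under homeomorphisms) satisfying the following conditions. (a) If $Z$ is metrizable, $Z\in\mathcal P$ and $F\subset Z$ is closed, then $F\in\mathcal P$. (b) If $Z,W$ are metrizable and $Z,W\in\mathcal P$, then $Z\times W\in\mathcal P$. (c) If $Z$ is a perfectly normal space and $Z=\bigcup_{n\in\mathbb N}F_n$ with each $F_n$ closed in $Z$ and $F_n\in\mathcal P$, then $Z\in\mathcal P$. (d) If $Z,W$ are metrizable, $f\colon Z\to W$ is a perfect map with finite fibres and $W\in\mathcal P$, then $Z\in\mathcal P$. If $X\in\mathcal P$, then $Y\in\mathcal P$. -/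

import Mathlib

open Topology TopologicalSpace

universe u

/-- `C_p(X)`: the real vector space of all continuous functions `X → ℝ`. As a subspace of the
product space `X → ℝ` it carries the topology of pointwise convergence. -/
def Cp (X : Type u) [TopologicalSpace X] : Submodule ℝ (X → ℝ) where
  carrier := {f | Continuous f}
  zero_mem' := continuous_const
  add_mem' := fun hf hg => Continuous.add hf hg
  smul_mem' := fun c _ hf => Continuous.const_smul hf c

/-- `C_p^*(X)`: the real vector space of all bounded continuous functions `X → ℝ`, again with the
topology of pointwise convergence. -/
def CpStar (X : Type u) [TopologicalSpace X] : Submodule ℝ (X → ℝ) where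
  carrier := {f | Continuous f ∧ ∃ M : ℝ, ∀ x, |f x| ≤ M}
  zero_mem' := ⟨continuous_const, 0, fun x => by simp⟩
  add_mem' := by
    rintro f g ⟨hf, M, hM⟩ ⟨hg, N, hN⟩
    exact ⟨hf.add hg, M + N, fun x => (abs_add_le _ _).trans (add_le_add (hM x) (hN x))⟩
  smul_mem' := by
    rintro c f ⟨hf, M, hM⟩
    refine ⟨hf.const_smul c, |c| * M, fun x => ?_⟩
    simpa [abs_mul] using mul_le_mul_of_nonneg_left (hM x) (abs_nonneg c)

/-- A perfect map: continuous, closed, with compact fibres (not necessarily onto). -/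
def IsPerfectMap {X Y : Type u} [TopologicalSpace X] [TopologicalSpace Y] (f : X → Y) : Prop :=
  Continuous f ∧ IsClosedMap f ∧ ∀ y, IsCompact (f ⁻¹' {y})

/-- A topological property, i.e. one that is invariant under homeomorphisms. -/
def IsTopologicalProperty (P : ∀ (Z : Type u) [TopologicalSpace Z], Prop) : Prop :=
  ∀ (Z W : Type u) [TopologicalSpace Z] [TopologicalSpace W], Nonempty (Z ≃ₜ W) → P Z → P W

/-- The four closure conditions on a property `P` of spaces. Heredity to closed subspaces, closure
under finite products and lifting along perfect maps are only required inside the class of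
metrizable spaces; the countable closed sum condition is required for perfectly normal T1 spaces
(in particular, for all metrizable spaces). -/
structure IsAdmissibleProperty (P : ∀ (Z : Type u) [TopologicalSpace Z], Prop) : Prop where
  /-- `P` passes to closed subspaces. -/
  closed_subspace : ∀ (Z : Type u) [TopologicalSpace Z] [MetrizableSpace Z],
    P Z → ∀ F : Set Z, IsClosed F → P F
  /-- `P` is closed under finite products. -/
  prod : ∀ (Z W : Type u) [TopologicalSpace Z] [TopologicalSpace W]
    [MetrizableSpace Z] [MetrizableSpace W], P Z → P W → P (Z × W)
  /-- `P` passes to countable unions of closed subspaces. -/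
  countable_closed_union : ∀ (Z : Type u) [TopologicalSpace Z] [T6Space Z] (F : ℕ → Set Z),
    (∀ n, IsClosed (F n)) → (∀ n, P (F n)) → (⋃ n, F n) = Set.univ → P Z
  /-- `P` lifts along perfect maps with finite fibres. -/
  perfect_preimage : ∀ (Z W : Type u) [TopologicalSpace Z] [TopologicalSpace W]
    [MetrizableSpace Z] [MetrizableSpace W] (f : Z → W),
    IsPerfectMap f → (∀ w, (f ⁻¹' {w}).Finite) → P W → P Z

/-! By continuity, each functional f ↦ (T f)(y) is a finitely supported measure μ y on X. Cut Y into
countably many pieces on which the support has a fixed size n, its points can be ordered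
continuously, and the weights are bounded by K. Listing the support in order maps a piece to X^n,
and this map is perfect with finite fibres. Fibres: surjectivity of T lets functions Σ
(weight)·f(support point) separate points of Y from finite sets, so distinct y with the same support
have linearly independent weight vectors in ℝ^n (`finite_preimage_sortedSupport`). Closedness: if
the supports converge, a subsequence of the bounded weights converges too, so every bounded
continuous function on Y converges along it. In a normal space this forces a cluster point
(`isClosed_image_sortedSupport`). Supports and weights together embed the piece in X^n × ℝ^n, so it
is metrizable and the perfect-map condition applies. Ordering uses Stone's well-ordering trick:
label z by the least point within r of it. Labels are locally constant on closed sets C exhausting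
X. Perfect normality makes the pieces closed in Y, since the set of y with at least n support points
is open and hence F_σ. -/

open Filter Set

/-! ### Finitely supported measures and duality -/

/-- The value at `f` of the finitely supported measure with weights `m`. -/
noncomputable def pairing {X : Type*} (m : X →₀ ℝ) (f : X → ℝ) : ℝ :=
  m.sum fun x c => c * f x

theorem pairing_eq_sum {X : Type*} (m : X →₀ ℝ) (f : X → ℝ) {n : ℕ} {x : Fin n → X}
    (hx : Function.Injective x) (hm : (m.support : Set X) ⊆ range x) :
    pairing m f = ∑ j, m (x j) * f (x j) := by
  classical
  have h : m.support ⊆ Finset.univ.image x := fun z hz => by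
    simpa using hm hz
  rw [pairing, Finsupp.sum_of_support_subset m h _ (by simp),
    Finset.sum_image (fun a _ b _ hab => hx hab)]

theorem exists_mem_support_of_pairing_ne_zero {X : Type*} {m : X →₀ ℝ} {f : X → ℝ}
    (h : pairing m f ≠ 0) : ∃ x ∈ m.support, f x ≠ 0 := by
  obtain ⟨x, hx, hne⟩ := Finset.exists_ne_zero_of_sum_ne_zero h
  exact ⟨x, hx, right_ne_zero_of_mul hne⟩

/-- A linear functional on a subspace of `X → ℝ` which is continuous for pointwise convergence is
given by a finitely supported measure. -/
theorem exists_finsupp_of_continuous {X : Type*} (D : Submodule ℝ (X → ℝ)) (φ : D →L[ℝ] ℝ) :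
    ∃ m : X →₀ ℝ, ∀ f : D, φ f = pairing m f := by
  classical
  let ev : X → D →ₗ[ℝ] ℝ := fun x => LinearMap.proj x ∘ₗ D.subtype
  obtain ⟨S, hS⟩ : ∃ S : Finset X, ∀ f : D, (∀ x ∈ S, (f : X → ℝ) x = 0) → φ f = 0 := by
    have h0 : φ ⁻¹' Metric.ball 0 1 ∈ 𝓝 (0 : D) :=
      φ.continuous.continuousAt.preimage_mem_nhds (by simpa using Metric.ball_mem_nhds _ one_pos)
    rw [nhds_subtype_eq_comap, mem_comap] at h0
    obtain ⟨U, hU, hUφ⟩ := h0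
    rw [nhds_pi, Filter.mem_pi] at hU
    obtain ⟨I, hI, t, ht, htU⟩ := hU
    refine ⟨hI.toFinset, fun f hf => ?_⟩
    by_contra hne
    -- Multiples of a function vanishing on `I` stay in the basic neighbourhood; this multiple has
    -- φ-value 1, outside the unit ball.
    have hmem : (φ f)⁻¹ • f ∈ φ ⁻¹' Metric.ball 0 1 := hUφ <| htU fun x hx => by
      have : (f : X → ℝ) x = 0 := hf x (by simpa using hx)
      have h2 := mem_of_mem_nhds (ht x)
      simpa [this] using h2
    simp [hne] at hmem
  have hspan := mem_span_of_iInf_ker_le_ker (L := fun x : S => ev x) (K := (φ : D →ₗ[ℝ] ℝ))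
    (fun f hf => by
      refine hS f fun x hx => ?_
      have := (Submodule.mem_iInf _).1 hf ⟨x, hx⟩
      exact this)
  obtain ⟨c, hc⟩ := (Submodule.mem_span_range_iff_exists_fun ℝ).1 hspan
  refine ⟨∑ x : S, Finsupp.single (x : X) (c x), fun f => ?_⟩
  have h1 : φ f = ∑ x : S, c x * (f : X → ℝ) x := by
    have := congrArg (fun L : D →ₗ[ℝ] ℝ => L f) hc
    simpa [ev, LinearMap.sum_apply] using this.symm
  have h2 : ∀ (s : Finset S), pairing (∑ x ∈ s, Finsupp.single (x : X) (c x)) (f : X → ℝ)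
      = ∑ x ∈ s, c x * (f : X → ℝ) x := by
    intro s
    rw [pairing, ← Finsupp.sum_finsetSum_index (fun _ => by simp) (fun _ _ _ => by ring)]
    exact Finset.sum_congr rfl fun x _ => Finsupp.sum_single_index (by simp)
  rw [h1, h2]

/-- `μ` is the family of finitely supported measures dual to a surjection between function
spaces over `X` and `Y` that contain all bounded continuous functions. -/
structure IsSurjectiveDual {X Y : Type*} [TopologicalSpace X] [TopologicalSpace Y]
    (μ : Y → X →₀ ℝ) : Prop where
  continuous_pairing : ∀ f : X → ℝ, Continuous f → (∃ M : ℝ, ∀ x, |f x| ≤ M) →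
    Continuous fun y => pairing (μ y) f
  exists_pairing_eq : ∀ g : Y → ℝ, Continuous g → (∃ M : ℝ, ∀ y, |g y| ≤ M) →
    ∃ f : X → ℝ, Continuous f ∧ ∀ y, pairing (μ y) f = g y

/-- Treats `Cp` and `CpStar` at once: only bounded test functions are needed on either side, and a
preimage under T need only be continuous. -/
theorem exists_isSurjectiveDual {X Y : Type*} [TopologicalSpace X] [TopologicalSpace Y]
    {D : Submodule ℝ (X → ℝ)} {E : Submodule ℝ (Y → ℝ)}
    (hD : ∀ f ∈ D, Continuous f) (hE : ∀ f ∈ E, Continuous f)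
    (hD' : ∀ f : X → ℝ, Continuous f → (∃ M : ℝ, ∀ x, |f x| ≤ M) → f ∈ D)
    (hE' : ∀ f : Y → ℝ, Continuous f → (∃ M : ℝ, ∀ x, |f x| ≤ M) → f ∈ E)
    (T : D →L[ℝ] E) (hT : Function.Surjective T) :
    ∃ μ : Y → X →₀ ℝ, IsSurjectiveDual μ := by
  have h : ∀ y : Y, ∃ m : X →₀ ℝ, ∀ f : D, (T f : Y → ℝ) y = pairing m f := fun y =>
    exists_finsupp_of_continuous D
      ((ContinuousLinearMap.proj (R := ℝ) (φ := fun _ : Y => ℝ) y ∘L E.subtypeL) ∘L T)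
  choose μ hμ using h
  refine ⟨μ, fun f hf hb => ?_, fun g hg hb => ?_⟩
  · convert hE _ (T ⟨f, hD' f hf hb⟩).2 using 1
    exact funext fun y => (hμ y ⟨f, hD' f hf hb⟩).symm
  · obtain ⟨f, hf⟩ := hT ⟨g, hE' g hg hb⟩
    exact ⟨f, hD _ f.2, fun y => by rw [← hμ, hf]⟩

/-! ### Cluster points in normal spaces -/

/-- A sequence in a normal T1 space along which all bounded continuous functions converge has a
cluster point. -/
theorem exists_mapClusterPt_of_tendsto {Y : Type*} [TopologicalSpace Y] [T4Space Y] (u : ℕ → Y)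
    (h : ∀ g : Y → ℝ, Continuous g → (∃ M : ℝ, ∀ y, |g y| ≤ M) →
      ∃ l, Tendsto (g ∘ u) atTop (𝓝 l)) :
    ∃ y, MapClusterPt y atTop u := by
  by_contra! hno
  have hlf : LocallyFinite fun t => ({u t} : Set Y) := fun y => by
    have := hno y
    simp only [mapClusterPt_iff_frequently, not_forall, not_frequently] at this
    obtain ⟨s, hs, hev⟩ := this
    refine ⟨s, hs, ?_⟩
    rw [← Nat.cofinite_eq_atTop, Filter.eventually_cofinite] at hev
    refine hev.subset fun t ht => ?_
    simpa using ht
  have hfin : ∀ y, {t | u t = y}.Finite := fun y =>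
    (hlf.point_finite y).subset fun t ht => by simpa using Eq.symm ht
  have hcl : ∀ R ⊆ range u, IsClosed R := fun R hR => by
    have : R = ⋃ t : {t // u t ∈ R}, {u t} := by
      ext y
      simp only [mem_iUnion, mem_singleton_iff, Subtype.exists]
      constructor
      · intro hy
        obtain ⟨t, rfl⟩ := hR hy
        exact ⟨t, hy, rfl⟩
      · rintro ⟨t, ht, rfl⟩
        exact ht
    rw [this]
    exact (hlf.comp_injective Subtype.val_injective).isClosed_iUnion fun _ => isClosed_singleton
  have hinf : (range u).Infinite := fun hf => by
    refine Set.infinite_univ (α := ℕ) ((hf.biUnion fun y _ => hfin y).subset fun t _ => ?_)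
    simp
  have hfreq : ∀ R ⊆ range u, R.Infinite → ∃ᶠ t in atTop, u t ∈ R := fun R hR hi hev => by
    rw [← Nat.cofinite_eq_atTop, Filter.eventually_cofinite] at hev
    refine hi ((hev.image u).subset fun y hy => ?_)
    obtain ⟨t, rfl⟩ := hR hy
    exact ⟨t, by simpa using hy, rfl⟩
  -- Halve the infinite closed discrete range; a Urysohn function for the two halves takes both
  -- values 0 and 1 infinitely often.
  obtain ⟨R, R', hu, hd, hc⟩ := hinf.exists_union_disjoint_cardinal_eq_of_infinite
  have hR : R ⊆ range u := hu ▸ subset_union_left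
  have hR' : R' ⊆ range u := hu ▸ subset_union_right
  have hiff : R.Finite ↔ R'.Finite := by
    rw [← Cardinal.lt_aleph0_iff_set_finite, ← Cardinal.lt_aleph0_iff_set_finite]
    simp [hc]
  have hRi : R.Infinite := fun hf => hinf (hu ▸ hf.union (hiff.1 hf))
  have hRi' : R'.Infinite := fun hf => hRi (hiff.2 hf)
  obtain ⟨g, h0, h1, hg⟩ := exists_continuous_zero_one_of_isClosed (hcl R hR) (hcl R' hR') hd
  obtain ⟨l, hl⟩ := h g g.continuous
    ⟨1, fun y => abs_le.2 ⟨by linarith [(hg y).1], (hg y).2⟩⟩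
  have e0 : l = 0 := by
    by_contra hne
    refine hfreq R hR hRi ((hl.eventually_ne hne).mono fun t ht hm => ht ?_)
    simpa using h0 hm
  have e1 : l = 1 := by
    by_contra hne
    refine hfreq R' hR' hRi' ((hl.eventually_ne hne).mono fun t ht hm => ht ?_)
    simpa using h1 hm
  exact zero_ne_one (e0.symm.trans e1)

/-! ### Semicontinuity and continuity of supports -/

/-- A Urysohn function for the ball of radius `r / 2` inside the ball of radius `r`. -/
noncomputable def ballBump {X : Type*} [MetricSpace X] (a : X) (r : ℝ) (z : X) : ℝ :=
  max 0 (min 1 (2 - 2 * dist z a / r))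

section ballBump
variable {X : Type*} [MetricSpace X] {a z : X} {r : ℝ}

theorem continuous_ballBump (a : X) (r : ℝ) : Continuous (ballBump a r) := by
  unfold ballBump
  fun_prop

theorem bounded_ballBump (a : X) (r : ℝ) : ∃ M : ℝ, ∀ z, |ballBump a r z| ≤ M := by
  refine ⟨1, fun z => ?_⟩
  rw [ballBump, abs_of_nonneg (le_max_left _ _)]
  exact max_le zero_le_one (min_le_left _ _)

theorem ballBump_eq_one (hr : 0 < r) (h : dist z a ≤ r / 2) : ballBump a r z = 1 := by
  have : 2 * dist z a / r ≤ 1 := by rw [div_le_one hr]; linarith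
  rw [ballBump, min_eq_left (by linarith), max_eq_right zero_le_one]

theorem ballBump_eq_zero (hr : 0 < r) (h : r ≤ dist z a) : ballBump a r z = 0 := by
  have : 2 ≤ 2 * dist z a / r := by rw [le_div_iff₀ hr]; linarith
  rw [ballBump, max_eq_left ((min_le_right _ _).trans (by linarith))]

theorem dist_lt_of_ballBump_ne_zero (hr : 0 < r) (h : ballBump a r z ≠ 0) : dist z a < r := by
  by_contra! hle
  exact h (ballBump_eq_zero hr hle)

end ballBump

theorem exists_pos_separation {X : Type*} [MetricSpace X] {n : ℕ} {x : Fin n → X}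
    (hx : Function.Injective x) : ∃ δ > 0, ∀ i j, i ≠ j → δ ≤ dist (x i) (x j) := by
  have h : ∀ᶠ δ in 𝓝[>] (0 : ℝ), ∀ i j, i ≠ j → δ ≤ dist (x i) (x j) := by
    simp only [eventually_all]
    intro i j hij
    exact nhdsWithin_le_nhds (Iic_mem_nhds (dist_pos.2 (hx.ne hij)))
  obtain ⟨δ, h1, h2⟩ := (h.and self_mem_nhdsWithin).exists
  exact ⟨δ, h2, h1⟩

theorem exists_enumeration {X : Type*} (s : Finset X) :
    ∃ x : Fin s.card → X, Function.Injective x ∧ range x = s := by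
  refine ⟨fun j => (s.equivFin.symm j : X),
    Subtype.val_injective.comp s.equivFin.symm.injective, ?_⟩
  ext z
  constructor
  · rintro ⟨j, rfl⟩
    exact (s.equivFin.symm j).2
  · intro hz
    exact ⟨s.equivFin ⟨z, hz⟩, by simp⟩

theorem range_eq_support_of_card {X : Type*} {s : Finset X} {n : ℕ} {x : Fin n → X}
    (hx : Function.Injective x) (hs : ∀ j, x j ∈ s) (hn : s.card = n) : range x = s := by
  classical
  have : Finset.univ.image x = s := Finset.eq_of_subset_of_card_le
    (fun z hz => by
      obtain ⟨j, -, rfl⟩ := Finset.mem_image.1 hz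
      exact hs j)
    (by rw [Finset.card_image_of_injective _ hx]; simp [hn])
  rw [← this]
  simp

namespace IsSurjectiveDual

section
variable {X Y : Type*} [MetricSpace X] [TopologicalSpace Y] {μ : Y → X →₀ ℝ}

/-- A bump around one support point has nonzero pairing at y₀, hence also nearby, so nearby supports
meet each of the disjoint balls. -/
theorem eventually_mem_support (hμ : IsSurjectiveDual μ) {y₀ : Y} {n : ℕ} {x₀ : Fin n → X}
    (hinj : Function.Injective x₀) (hsupp : range x₀ = (μ y₀).support) {δ : ℝ} (hδ : 0 < δ)
    (hsep : ∀ i j, i ≠ j → 2 * δ ≤ dist (x₀ i) (x₀ j)) :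
    ∀ᶠ y in 𝓝 y₀, ∃ x : Fin n → X, Function.Injective x ∧ (∀ j, x j ∈ (μ y).support) ∧
      ∀ j, dist (x j) (x₀ j) < δ := by
  have hne : ∀ j, pairing (μ y₀) (ballBump (x₀ j) δ) ≠ 0 := fun j => by
    rw [pairing_eq_sum _ _ hinj hsupp.ge, Finset.sum_eq_single j]
    · rw [ballBump_eq_one hδ (by simpa using (half_pos hδ).le), mul_one]
      exact Finsupp.mem_support_iff.1 (hsupp.le ⟨j, rfl⟩)
    · intro i _ hij
      rw [ballBump_eq_zero hδ (by linarith [hsep i j hij]), mul_zero]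
    · simp
  have hev : ∀ᶠ y in 𝓝 y₀, ∀ j, pairing (μ y) (ballBump (x₀ j) δ) ≠ 0 :=
    eventually_all.2 fun j => (hμ.continuous_pairing _ (continuous_ballBump _ _)
      (bounded_ballBump _ _)).continuousAt.eventually_ne (hne j)
  filter_upwards [hev] with y hy
  have hy' : ∀ j, ∃ z ∈ (μ y).support, dist z (x₀ j) < δ := fun j => by
    obtain ⟨z, hz, hz'⟩ := exists_mem_support_of_pairing_ne_zero (hy j)
    exact ⟨z, hz, dist_lt_of_ballBump_ne_zero hδ hz'⟩
  choose x hx hxd using hy'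
  refine ⟨x, fun i j hij => ?_, hx, hxd⟩
  by_contra hne
  have h1 := hsep i j hne
  have h2 := dist_triangle_left (x₀ i) (x₀ j) (x i)
  have h3 := hxd i
  have h4 := hxd j
  rw [← hij] at h4
  linarith

theorem isOpen_le_card_support (hμ : IsSurjectiveDual μ) (n : ℕ) :
    IsOpen {y | n ≤ (μ y).support.card} := by
  rw [isOpen_iff_mem_nhds]
  intro y₀ hy₀
  obtain ⟨x₀, hinj, hsupp⟩ := exists_enumeration (μ y₀).support
  obtain ⟨δ, hδ, hsep⟩ := exists_pos_separation hinj
  filter_upwards [hμ.eventually_mem_support hinj hsupp (half_pos hδ)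
    (fun i j hij => by linarith [hsep i j hij])] with y hy
  obtain ⟨x, hx, hmem, -⟩ := hy
  calc n ≤ (μ y₀).support.card := hy₀
    _ = (Finset.univ.map ⟨x, hx⟩).card := by simp
    _ ≤ _ := Finset.card_le_card fun z hz => by
      obtain ⟨j, -, rfl⟩ := Finset.mem_map.1 hz
      exact hmem j

/-- Supports of constant cardinality and their weights vary continuously. -/
theorem eventually_enumeration (hμ : IsSurjectiveDual μ) {y₀ : Y} {n : ℕ} {x₀ : Fin n → X}
    (hinj : Function.Injective x₀) (hsupp : range x₀ = (μ y₀).support) {ε : ℝ} (hε : 0 < ε) :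
    ∀ᶠ y in 𝓝 y₀, (μ y).support.card = n → ∃ x : Fin n → X, Function.Injective x ∧
      range x = (μ y).support ∧
      ∀ j, dist (x j) (x₀ j) < ε ∧ |μ y (x j) - μ y₀ (x₀ j)| < ε := by
  obtain ⟨δ', hδ', hsep'⟩ := exists_pos_separation hinj
  obtain ⟨δ, hδ, hδε, hδδ'⟩ : ∃ δ > 0, δ ≤ ε ∧ 2 * δ ≤ δ' :=
    ⟨min ε (δ' / 2), lt_min hε (half_pos hδ'), min_le_left _ _,
      by linarith [min_le_right ε (δ' / 2)]⟩
  have hsep : ∀ i j, i ≠ j → 2 * δ ≤ dist (x₀ i) (x₀ j) := fun i j hij =>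
    hδδ'.trans (hsep' i j hij)
  -- The bump at `x₀ j` is 1 at `x j` and 0 at the other support points, so the pairing reads off a
  -- single weight.
  have key : ∀ (y : Y) (x : Fin n → X), Function.Injective x → range x = (μ y).support →
      (∀ j, dist (x j) (x₀ j) < δ / 2) → ∀ j, pairing (μ y) (ballBump (x₀ j) δ) = μ y (x j) := by
    intro y x hx hr hd j
    rw [pairing_eq_sum _ _ hx hr.ge, Finset.sum_eq_single j]
    · rw [ballBump_eq_one hδ (hd j).le, mul_one]
    · intro i _ hij
      have h1 := hsep i j hij
      have h2 := dist_triangle_left (x₀ i) (x₀ j) (x i)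
      have h3 := hd i
      rw [ballBump_eq_zero hδ (by linarith), mul_zero]
    · simp
  have hev : ∀ᶠ y in 𝓝 y₀, ∀ j,
      |pairing (μ y) (ballBump (x₀ j) δ) - pairing (μ y₀) (ballBump (x₀ j) δ)| < ε :=
    eventually_all.2 fun j => (hμ.continuous_pairing _ (continuous_ballBump _ _)
      (bounded_ballBump _ _)).continuousAt.eventually (Metric.ball_mem_nhds _ hε)
  filter_upwards [hev, hμ.eventually_mem_support hinj hsupp (half_pos hδ)
    (fun i j hij => by linarith [hsep i j hij])] with y hy ⟨x, hx, hmem, hd⟩ hcard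
  have hr := range_eq_support_of_card hx hmem hcard
  refine ⟨x, hx, hr, fun j => ⟨by linarith [hd j], ?_⟩⟩
  have := hy j
  rwa [key y x hx hr hd, key y₀ x₀ hinj hsupp (fun j => by simpa using hδ)] at this

end

end IsSurjectiveDual

/-! ### Locally constant labels on a metric space -/

/-- The least point, in a given well-order, at distance less than `r` from `z`. -/
noncomputable def leastNear {X : Type*} [MetricSpace X] [LinearOrder X] [WellFoundedLT X] {r : ℝ}
    (hr : 0 < r) (z : X) : X :=
  wellFounded_lt.min {x | dist z x < r} ⟨z, by simpa using hr⟩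

section leastNear
variable {X : Type*} [MetricSpace X] [LinearOrder X] [WellFoundedLT X] {r : ℝ} (hr : 0 < r)

theorem dist_leastNear_lt (z : X) : dist z (leastNear hr z) < r :=
  wellFounded_lt.min_mem {x | dist z x < r} _

theorem leastNear_le {z x : X} (h : dist z x < r) : leastNear hr z ≤ x :=
  not_lt.1 (wellFounded_lt.not_lt_min {x | dist z x < r} h)

/-- The slack η makes the label of each point a competitor for the label of the other. -/
theorem leastNear_eq_of_dist_lt {η : ℝ} {z w : X} (hz : dist z (leastNear hr z) ≤ r - η)
    (hw : dist w (leastNear hr w) ≤ r - η) (h : dist z w < η) :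
    leastNear hr z = leastNear hr w := by
  refine le_antisymm (leastNear_le hr ?_) (leastNear_le hr ?_)
  · linarith [dist_triangle z w (leastNear hr w)]
  · linarith [dist_triangle_left w (leastNear hr z) z]

theorem isClosed_setOf_dist_leastNear_le {η : ℝ} (hη : 0 < η) :
    IsClosed {z : X | dist z (leastNear hr z) ≤ r - η} := by
  rw [← isSeqClosed_iff_isClosed]
  intro u z hu hz
  have hd : ∀ {ε : ℝ}, 0 < ε → ∀ᶠ t in atTop, dist (u t) z < ε := fun hε =>
    hz (Metric.ball_mem_nhds z hε)
  obtain ⟨t₀, ht₀⟩ := (hd (half_pos hη)).exists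
  have hx : ∀ᶠ t in atTop, leastNear hr (u t) = leastNear hr (u t₀) := by
    filter_upwards [hd (half_pos hη)] with t ht
    exact leastNear_eq_of_dist_lt hr (hu t) (hu t₀) (by linarith [dist_triangle_right (u t) (u t₀) z])
  have hle : dist z (leastNear hr (u t₀)) ≤ r - η := by
    refine le_of_tendsto (hz.dist tendsto_const_nhds) ?_
    filter_upwards [hx] with t ht
    rw [← ht]
    exact hu t
  have heq : leastNear hr z = leastNear hr (u t₀) := by
    refine le_antisymm (leastNear_le hr (by linarith)) ?_
    obtain ⟨t, ht, ht'⟩ := (hx.and (hd (sub_pos.2 (dist_leastNear_lt hr z)))).exists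
    rw [← ht]
    exact leastNear_le hr (by linarith [dist_triangle (u t) z (leastNear hr z)])
  rw [mem_ofPred_eq, heq]
  exact hle

end leastNear

/-! ### Strata and sorted supports -/

section stratum
variable {X : Type*} {Y : Type*} {L : Type*}

/-- The points whose measure has `n` support points, all in `C` and with different indices `i`,
and weights at most `K`. -/
def stratum (μ : Y → X →₀ ℝ) (n : ℕ) (C : Set X) (i : X → L) (K : ℝ) : Set Y :=
  {y | (μ y).support.card = n ∧ ((μ y).support : Set X) ⊆ C ∧
    InjOn i (μ y).support ∧ ∀ x, |μ y x| ≤ K}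

variable [LinearOrder L] {μ : Y → X →₀ ℝ} {n : ℕ} {C : Set X} {i : X → L} {K : ℝ}

theorem exists_strictMono_enumeration {s : Finset X} (hs : s.card = n) (hi : InjOn i s) :
    ∃ x : Fin n → X, StrictMono (i ∘ x) ∧ range x = s := by
  classical
  have hc : (s.image i).card = n := by rw [Finset.card_image_of_injOn hi, hs]
  have hmem : ∀ j, ∃ z ∈ s, i z = (s.image i).orderEmbOfFin hc j := fun j =>
    Finset.mem_image.1 ((s.image i).orderEmbOfFin_mem hc j)
  choose x hx hxi using hmem
  have hm : StrictMono (i ∘ x) := fun a b hab => by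
    simpa [hxi] using hab
  exact ⟨x, hm, range_eq_support_of_card (Function.Injective.of_comp hm.injective) hx hs⟩

theorem enumeration_unique {s : Set X} (hi : InjOn i s) {x x' : Fin n → X}
    (hx : StrictMono (i ∘ x)) (hx' : StrictMono (i ∘ x')) (hr : range x = s)
    (hr' : range x' = s) : x = x' := by
  have h : i ∘ x = i ∘ x' := by
    rw [← hx.range_inj hx', range_comp, range_comp, hr, hr']
  funext j
  exact hi (hr.le ⟨j, rfl⟩) (hr'.le ⟨j, rfl⟩) (congrFun h j)

/-- The support points of a point of a stratum, sorted by their indices. -/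
noncomputable def sortedSupport (y : stratum μ n C i K) : Fin n → X :=
  (exists_strictMono_enumeration y.2.1 y.2.2.2.1).choose

theorem strictMono_sortedSupport (y : stratum μ n C i K) : StrictMono (i ∘ sortedSupport y) :=
  (exists_strictMono_enumeration y.2.1 y.2.2.2.1).choose_spec.1

theorem injective_sortedSupport (y : stratum μ n C i K) :
    Function.Injective (sortedSupport y) :=
  Function.Injective.of_comp (strictMono_sortedSupport y).injective

theorem range_sortedSupport (y : stratum μ n C i K) :
    range (sortedSupport y) = (μ y).support :=
  (exists_strictMono_enumeration y.2.1 y.2.2.2.1).choose_spec.2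

/-- The weights of the sorted support points. -/
noncomputable def sortedWeight (y : stratum μ n C i K) (j : Fin n) : ℝ :=
  μ y (sortedSupport y j)

theorem pairing_eq_sum_sorted (y : stratum μ n C i K) (f : X → ℝ) :
    pairing (μ y) f = ∑ j, sortedWeight y j * f (sortedSupport y j) :=
  pairing_eq_sum _ _ (injective_sortedSupport y) (range_sortedSupport y).ge

end stratum

/-! ### The sorted support as a perfect map -/

namespace IsSurjectiveDual

variable {X Y L : Type*} [MetricSpace X] [TopologicalSpace Y]
  {μ : Y → X →₀ ℝ} {n : ℕ} {C : Set X} {i : X → L} {K : ℝ}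

/-- A stratum is relatively closed in the set of points whose measure has `n` support points. -/
theorem mem_stratum_of_mem_closure (hμ : IsSurjectiveDual μ) (hC : IsClosed C)
    (hi : ∀ z ∈ C, ∀ᶠ w in 𝓝[C] z, i w = i z) {y₀ : Y} (hn : (μ y₀).support.card = n)
    (hy₀ : y₀ ∈ closure (stratum μ n C i K)) : y₀ ∈ stratum μ n C i K := by
  obtain ⟨x₀, hinj, hsupp⟩ : ∃ x : Fin n → X, Function.Injective x ∧
      range x = (μ y₀).support := by
    subst hn
    exact exists_enumeration _
  have hfreq := mem_closure_iff_frequently.1 hy₀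
  have happ : ∀ ε > 0, ∃ y ∈ stratum μ n C i K, ∃ x : Fin n → X, Function.Injective x ∧
      range x = (μ y).support ∧
      ∀ j, dist (x j) (x₀ j) < ε ∧ |μ y (x j) - μ y₀ (x₀ j)| < ε := fun ε hε => by
    obtain ⟨y, hy, hy'⟩ := (hfreq.and_eventually
      (hμ.eventually_enumeration hinj hsupp hε)).exists
    exact ⟨y, hy, hy' hy.1⟩
  have hxC : ∀ j, x₀ j ∈ C := fun j => by
    rw [← hC.closure_eq, Metric.mem_closure_iff]
    intro ε hε
    obtain ⟨y, hy, x, -, hx, hd⟩ := happ ε hε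
    exact ⟨x j, hy.2.1 (hx.le ⟨j, rfl⟩), by rw [dist_comm]; exact (hd j).1⟩
  refine ⟨hn, ?_, ?_, fun z => ?_⟩
  · rw [← hsupp]
    exact range_subset_iff.2 hxC
  · obtain ⟨ε, hε, hεi⟩ : ∃ ε > 0, ∀ j, ∀ w ∈ C, dist w (x₀ j) < ε → i w = i (x₀ j) := by
      have : ∀ᶠ ε in 𝓝[>] (0 : ℝ), ∀ j, ∀ w ∈ C, dist w (x₀ j) < ε → i w = i (x₀ j) := by
        refine eventually_all.2 fun j => ?_
        obtain ⟨ε, hε, h⟩ := Metric.mem_nhdsWithin_iff.1 (hi _ (hxC j))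
        filter_upwards [Ioo_mem_nhdsGT hε] with δ hδ w hw hwd
        exact h ⟨hwd.trans hδ.2, hw⟩
      obtain ⟨ε, h1, h2⟩ := (this.and self_mem_nhdsWithin).exists
      exact ⟨ε, h2, h1⟩
    obtain ⟨y, hy, x, hxinj, hx, hd⟩ := happ ε hε
    have hix : ∀ j, i (x j) = i (x₀ j) := fun j =>
      hεi j _ (hy.2.1 (hx.le ⟨j, rfl⟩)) (hd j).1
    rw [← hsupp]
    rintro _ ⟨a, rfl⟩ _ ⟨b, rfl⟩ hab
    rw [← hix, ← hix] at hab
    rw [hxinj (hy.2.2.1 (hx.le ⟨a, rfl⟩) (hx.le ⟨b, rfl⟩) hab)]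
  · obtain ⟨y₁, hy₁⟩ := hfreq.exists
    by_cases hz : z ∈ (μ y₀).support
    · obtain ⟨j, rfl⟩ := hsupp.ge hz
      refine le_of_forall_pos_le_add fun ε hε => ?_
      obtain ⟨y, hy, x, -, -, hd⟩ := happ ε hε
      have h1 := hy.2.2.2 (x j)
      have h2 := (hd j).2
      have h3 := abs_sub_abs_le_abs_sub (μ y₀ (x₀ j)) (μ y (x j))
      rw [abs_sub_comm] at h3
      linarith
    · rw [Finsupp.notMem_support_iff.1 hz, abs_zero]
      exact (abs_nonneg _).trans (hy₁.2.2.2 z)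

variable [LinearOrder L]

/-- Near y₀ the enumeration following that of y₀ carries the same labels, hence is itself the sorted
one. -/
theorem continuous_sorted (hμ : IsSurjectiveDual μ)
    (hi : ∀ z ∈ C, ∀ᶠ w in 𝓝[C] z, i w = i z) :
    Continuous fun y : stratum μ n C i K => (sortedSupport y, sortedWeight y) := by
  have key : ∀ (y₀ : stratum μ n C i K) (ε : ℝ), 0 < ε → ∀ᶠ y in 𝓝 y₀, ∀ j,
      dist (sortedSupport y j) (sortedSupport y₀ j) < ε ∧
        |sortedWeight y j - sortedWeight y₀ j| < ε := by
    intro y₀ ε hε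
    have hxC : ∀ j, sortedSupport y₀ j ∈ C := fun j =>
      y₀.2.2.1 ((range_sortedSupport y₀).le ⟨j, rfl⟩)
    have : ∀ᶠ δ in 𝓝[>] (0 : ℝ), ∀ j, ∀ w ∈ C, dist w (sortedSupport y₀ j) < δ →
        i w = i (sortedSupport y₀ j) := by
      refine eventually_all.2 fun j => ?_
      obtain ⟨δ', hδ', h⟩ := Metric.mem_nhdsWithin_iff.1 (hi _ (hxC j))
      filter_upwards [Ioo_mem_nhdsGT hδ'] with δ hδ w hw hwd
      exact h ⟨hwd.trans hδ.2, hw⟩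
    obtain ⟨δ, hδi, hδ, hδε⟩ := (this.and (Ioo_mem_nhdsGT hε)).exists
    have hev := hμ.eventually_enumeration (injective_sortedSupport y₀)
      (range_sortedSupport y₀) hδ
    filter_upwards [continuous_subtype_val.continuousAt.eventually hev] with y hy
    obtain ⟨x, hxinj, hx, hd⟩ := hy y.2.1
    have hix : i ∘ x = i ∘ sortedSupport y₀ := funext fun j =>
      hδi j _ (y.2.2.1 (hx.le ⟨j, rfl⟩)) (hd j).1
    have hxe : x = sortedSupport y := enumeration_unique y.2.2.2.1
      (hix ▸ strictMono_sortedSupport y₀) (strictMono_sortedSupport y) hx (range_sortedSupport y)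
    subst hxe
    exact fun j => ⟨(hd j).1.trans hδε, (hd j).2.trans hδε⟩
  refine Continuous.prodMk (continuous_pi fun j => ?_) (continuous_pi fun j => ?_)
  · rw [continuous_iff_continuousAt]
    exact fun y₀ => Metric.tendsto_nhds.2 fun ε hε => (key y₀ ε hε).mono fun y hy => (hy j).1
  · rw [continuous_iff_continuousAt]
    exact fun y₀ => Metric.tendsto_nhds.2 fun ε hε => (key y₀ ε hε).mono fun y hy => (hy j).2

theorem continuous_sortedSupport (hμ : IsSurjectiveDual μ)
    (hi : ∀ z ∈ C, ∀ᶠ w in 𝓝[C] z, i w = i z) :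
    Continuous (sortedSupport : stratum μ n C i K → Fin n → X) :=
  continuous_fst.comp (hμ.continuous_sorted hi)

theorem exists_pairing_separating [CompletelyRegularSpace Y]
    (hμ : IsSurjectiveDual μ) {y : Y} {A : Set Y} (hA : IsClosed A) (hy : y ∉ A) :
    ∃ f : X → ℝ, Continuous f ∧ pairing (μ y) f = 1 ∧ ∀ z ∈ A, pairing (μ z) f = 0 := by
  obtain ⟨g, hg, hgy, hgA⟩ := CompletelyRegularSpace.completely_regular y A hA hy
  obtain ⟨f, hf, hfg⟩ := hμ.exists_pairing_eq (fun z => 1 - (g z : ℝ)) (by fun_prop)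
    ⟨1, fun z => abs_le.2 ⟨by linarith [(g z).2.2], by linarith [(g z).2.1]⟩⟩
  refine ⟨f, hf, by simp [hfg, hgy], fun z hz => ?_⟩
  simp [hfg, hgA hz]

theorem support_nonempty [CompletelyRegularSpace Y] (hμ : IsSurjectiveDual μ) (y : Y) :
    (μ y).support.Nonempty := by
  obtain ⟨f, -, hf, -⟩ := hμ.exists_pairing_separating (y := y) isClosed_empty (by simp)
  obtain ⟨x, hx, -⟩ := exists_mem_support_of_pairing_ne_zero (hf.trans_ne one_ne_zero)
  exact ⟨x, hx⟩

theorem isEmbedding_sorted [T1Space Y] [CompletelyRegularSpace Y] (hμ : IsSurjectiveDual μ)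
    (hi : ∀ z ∈ C, ∀ᶠ w in 𝓝[C] z, i w = i z) :
    IsEmbedding fun y : stratum μ n C i K => (sortedSupport y, sortedWeight y) := by
  have hind : IsInducing fun y : stratum μ n C i K => (sortedSupport y, sortedWeight y) := by
    refine isInducing_iff_nhds.2 fun y => le_antisymm
      ((hμ.continuous_sorted hi).continuousAt.le_comap) fun s hs => ?_
    rw [nhds_subtype_eq_comap, mem_comap] at hs
    obtain ⟨U, hU, hUs⟩ := hs
    obtain ⟨V, hVU, hV, hyV⟩ := mem_nhds_iff.1 hU
    obtain ⟨f, hf, hfy, hfV⟩ := hμ.exists_pairing_separating hV.isClosed_compl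
      (y := (y : Y)) (by simpa using hyV)
    -- Pairing with `f` extends continuously to (X^n) × ℝ^n; it is 1 at y and 0 off `V`.
    refine mem_comap.2 ⟨{p | 0 < ∑ j, p.2 j * f (p.1 j)}, ?_, fun z hz => hUs ?_⟩
    · refine IsOpen.mem_nhds (isOpen_lt continuous_const (by fun_prop)) ?_
      rw [mem_ofPred_eq, ← pairing_eq_sum_sorted, hfy]
      exact one_pos
    · by_contra hzU
      have := hfV z fun hzV => hzU (hVU hzV)
      have hz' : 0 < ∑ j, sortedWeight z j * f (sortedSupport z j) := hz
      rw [← pairing_eq_sum_sorted, this] at hz'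
      exact lt_irrefl _ hz'
  exact hind.isEmbedding

theorem finite_preimage_sortedSupport [T1Space Y] [CompletelyRegularSpace Y]
    (hμ : IsSurjectiveDual μ) (w : Fin n → X) :
    ((sortedSupport : stratum μ n C i K → Fin n → X) ⁻¹' {w}).Finite := by
  classical
  have hli : LinearIndependent ℝ
      fun y : (sortedSupport : stratum μ n C i K → Fin n → X) ⁻¹' {w} => sortedWeight y.1 := by
    refine linearIndependent_iff'.2 fun s c hc y hy => ?_
    obtain ⟨f, -, hfy, hfA⟩ := hμ.exists_pairing_separating
      (y := (y.1 : Y)) (A := (fun z : (sortedSupport : stratum μ n C i K → Fin n → X) ⁻¹' {w} =>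
        (z.1 : Y)) '' ↑(s.erase y)) ((s.erase y).finite_toSet.image _).isClosed (by
          rintro ⟨z, hz, hzy⟩
          have : z = y := Subtype.ext (Subtype.ext hzy)
          simp [this] at hz)
    have hpair : ∀ z : (sortedSupport : stratum μ n C i K → Fin n → X) ⁻¹' {w},
        pairing (μ z.1) f = ∑ j, sortedWeight z.1 j * f (w j) := fun z => by
      rw [pairing_eq_sum_sorted, show sortedSupport z.1 = w from z.2]
    calc c y = ∑ z ∈ s, c z * pairing (μ z.1) f := by
          rw [Finset.sum_eq_single_of_mem y hy, hfy, mul_one]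
          intro z hz hzy
          rw [hfA _ ⟨z, by simp [hz, hzy], rfl⟩, mul_zero]
      _ = ∑ j, (∑ z ∈ s, c z • sortedWeight z.1) j * f (w j) := by
          simp_rw [hpair, Finset.mul_sum, Finset.sum_apply, Finset.sum_mul]
          rw [Finset.sum_comm]
          simp [mul_assoc]
      _ = 0 := by rw [hc]; simp
  exact Set.finite_coe_iff.1 hli.finite

/-- A part of a stratum that is closed in the whole space is mapped onto a closed set. -/
theorem isClosed_image_sortedSupport [T4Space Y] (hμ : IsSurjectiveDual μ)
    (hi : ∀ z ∈ C, ∀ᶠ w in 𝓝[C] z, i w = i z) {A : Set (stratum μ n C i K)}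
    (hA : IsClosed (Subtype.val '' A)) : IsClosed (sortedSupport '' A) := by
  rw [← isSeqClosed_iff_isClosed]
  intro v w hv hw
  choose u huA huv using hv
  -- This is where the weight bound `K` is used.
  obtain ⟨l, -, φ, hφ, hl⟩ := (isCompact_univ_pi fun _ : Fin n => isCompact_Icc (a := -K)
    (b := K)).tendsto_subseq (x := fun t => sortedWeight (u t))
    (fun t j _ => abs_le.1 ((u t).2.2.2.2 _))
  have hwφ : Tendsto (fun t => sortedSupport (u (φ t))) atTop (𝓝 w) := by
    simp_rw [huv]
    exact hw.comp hφ.tendsto_atTop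
  obtain ⟨y, hy⟩ := exists_mapClusterPt_of_tendsto (fun t => (u (φ t) : Y)) fun g hg hb => by
    obtain ⟨f, hf, hfg⟩ := hμ.exists_pairing_eq g hg hb
    refine ⟨∑ j, l j * f (w j), ?_⟩
    have h : Tendsto (fun t => ∑ j, sortedWeight (u (φ t)) j * f (sortedSupport (u (φ t)) j))
        atTop (𝓝 (∑ j, l j * f (w j))) :=
      tendsto_finsetSum _ fun j _ => ((tendsto_pi_nhds.1 hl j).mul
        ((hf.tendsto _).comp (tendsto_pi_nhds.1 hwφ j)))
    refine h.congr fun t => ?_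
    rw [← pairing_eq_sum_sorted, hfg, Function.comp_apply]
  obtain ⟨y', hy'A, rfl⟩ : y ∈ Subtype.val '' A :=
    hA.mem_of_mapClusterPt hy (Eventually.of_forall fun t => ⟨u (φ t), huA _, rfl⟩)
  have hy' : MapClusterPt y' atTop fun t => u (φ t) := by
    refine mapClusterPt_iff_frequently.2 fun s hs => ?_
    rw [nhds_subtype_eq_comap, mem_comap] at hs
    obtain ⟨U, hU, hUs⟩ := hs
    exact (hy.frequently hU).mono fun t ht => hUs ht
  have h := hy'.continuousAt_comp (hμ.continuous_sortedSupport hi).continuousAt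
  exact ⟨y', hy'A, eq_of_nhds_neBot (h.clusterPt.mono hwφ)⟩

end IsSurjectiveDual

/-! ### Countable decomposition into closed pieces -/

theorem IsAdmissibleProperty.pi_fin_succ {P : ∀ (Z : Type u) [TopologicalSpace Z], Prop}
    (hP : IsTopologicalProperty P) (hPad : IsAdmissibleProperty P) {X : Type u}
    [TopologicalSpace X] [MetrizableSpace X] (hX : P X) (n : ℕ) : P (Fin (n + 1) → X) := by
  induction n with
  | zero => exact hP _ _ ⟨(Homeomorph.funUnique (Fin 1) X).symm⟩ hX
  | succ n ih =>
    refine hP _ _ ⟨?_⟩ (hPad.prod _ _ hX ih)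
    exact
      { Fin.consEquiv fun _ : Fin (n + 2) => X with
        continuous_toFun := by
          refine continuous_pi fun j => ?_
          refine Fin.cases ?_ (fun j => ?_) j
          · exact continuous_fst
          · exact (continuous_apply j).comp continuous_snd
        continuous_invFun := by
          refine Continuous.prodMk (continuous_apply _) (continuous_pi fun j => ?_)
          exact continuous_apply _ }

theorem IsOpen.exists_iUnion_isClosed_of_perfectlyNormal {Y : Type*} [TopologicalSpace Y]
    [PerfectlyNormalSpace Y] {U : Set Y} (hU : IsOpen U) :
    ∃ B : ℕ → Set Y, (∀ b, IsClosed (B b)) ∧ ⋃ b, B b = U := by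
  obtain ⟨V, hV, hVU⟩ := (PerfectlyNormalSpace.closed_gdelta hU.isClosed_compl).eq_iInter_nat
  refine ⟨fun b => (V b)ᶜ, fun b => (hV b).isClosed_compl, ?_⟩
  rw [← compl_iInter, ← hVU, compl_compl]

namespace IsSurjectiveDual

theorem isClosed_stratum_inter {X Y L : Type*} [MetricSpace X] [TopologicalSpace Y]
    {μ : Y → X →₀ ℝ} {n : ℕ} {C : Set X} {i : X → L} {K : ℝ}
    (hμ : IsSurjectiveDual μ) (hC : IsClosed C) (hi : ∀ z ∈ C, ∀ᶠ w in 𝓝[C] z, i w = i z)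
    {B : Set Y} (hB : IsClosed B) (hBn : B ⊆ {y | n ≤ (μ y).support.card}) :
    IsClosed (stratum μ n C i K ∩ B) := by
  refine isClosed_of_closure_subset fun y hy => ?_
  have hyB : y ∈ B := hB.closure_subset_iff.2 inter_subset_right hy
  have hys := closure_mono inter_subset_left hy
  -- Support size cannot jump up in a limit, and membership in `B` keeps it from dropping.
  have hle : y ∈ {y | n + 1 ≤ (μ y).support.card}ᶜ :=
    (hμ.isOpen_le_card_support (n + 1)).isClosed_compl.closure_subset_iff.2
      (fun z hz => by
        have := hz.1
        simp only [mem_compl_iff, mem_ofPred_eq]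
        omega) hys
  have h1 : n ≤ (μ y).support.card := hBn hyB
  simp only [mem_compl_iff, mem_ofPred_eq] at hle
  exact ⟨hμ.mem_stratum_of_mem_closure hC hi (by omega) hys, hyB⟩

theorem property_stratum_inter {X Y : Type u} {L : Type*} [MetricSpace X] [TopologicalSpace Y]
    [T4Space Y] [LinearOrder L] {μ : Y → X →₀ ℝ} {n : ℕ} {C : Set X} {i : X → L} {K : ℝ}
    (hμ : IsSurjectiveDual μ) (hi : ∀ z ∈ C, ∀ᶠ w in 𝓝[C] z, i w = i z)
    {B : Set Y} (hD : IsClosed (stratum μ n C i K ∩ B))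
    {P : ∀ (Z : Type u) [TopologicalSpace Z], Prop} (hPad : IsAdmissibleProperty P)
    (hX : P (Fin n → X)) : P ↥(stratum μ n C i K ∩ B) := by
  have hinc : IsEmbedding (inclusion (inter_subset_left : stratum μ n C i K ∩ B ⊆ _)) :=
    IsEmbedding.inclusion _
  have : MetrizableSpace ↥(stratum μ n C i K ∩ B) :=
    ((hμ.isEmbedding_sorted hi).comp hinc).metrizableSpace
  have hfin : ∀ w, ((sortedSupport ∘
      inclusion (inter_subset_left : stratum μ n C i K ∩ B ⊆ _)) ⁻¹' {w}).Finite := fun w => by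
    rw [preimage_comp]
    exact (hμ.finite_preimage_sortedSupport w).preimage hinc.injective.injOn
  refine hPad.perfect_preimage _ _
    (sortedSupport ∘ inclusion (inter_subset_left : stratum μ n C i K ∩ B ⊆ _))
    ⟨(hμ.continuous_sortedSupport hi).comp hinc.continuous, fun A hA => ?_,
      fun w => (hfin w).isCompact⟩ hfin hX
  rw [image_comp]
  refine hμ.isClosed_image_sortedSupport hi ?_
  rw [← image_comp]
  exact hD.isClosedMap_subtype_val A hA

/-- The dual family of a surjection transfers an admissible property from a metric space to a
perfectly normal space. -/
theorem property_of_property {X Y : Type u} [MetricSpace X] [TopologicalSpace Y] [T6Space Y]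
    {μ : Y → X →₀ ℝ} (hμ : IsSurjectiveDual μ) {P : ∀ (Z : Type u) [TopologicalSpace Z], Prop}
    (hP : IsTopologicalProperty P) (hPad : IsAdmissibleProperty P) (hX : P X) : P Y := by
  obtain ⟨_, _⟩ := exists_wellFoundedLT X
  choose B hB hBU using fun n =>
    -- Supports are nonempty, so only the positive powers of X occur.
    (hμ.isOpen_le_card_support (n + 1)).exists_iUnion_isClosed_of_perfectlyNormal
  have hpos : ∀ m : ℕ, (0 : ℝ) < 1 / (m + 1) := fun m => Nat.one_div_pos_of_nat
  let C : ℕ → ℕ → Set X := fun m k =>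
    {z | dist z (leastNear (hpos m) z) ≤ 1 / ((m : ℝ) + 1) - 1 / ((k : ℝ) + 1)}
  have hC : ∀ m k, IsClosed (C m k) := fun m k =>
    isClosed_setOf_dist_leastNear_le (hpos m) (hpos k)
  have hi : ∀ m k, ∀ z ∈ C m k, ∀ᶠ w in 𝓝[C m k] z,
      leastNear (hpos m) w = leastNear (hpos m) z := fun m k z hz => by
    filter_upwards [self_mem_nhdsWithin, nhdsWithin_le_nhds (Metric.ball_mem_nhds z (hpos k))]
      with w hw hwz
    exact leastNear_eq_of_dist_lt (hpos m) hw hz hwz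
  let F : ℕ × ℕ × ℕ × ℕ × ℕ → Set Y := fun p =>
    stratum μ (p.1 + 1) (C p.2.1 p.2.2.1) (leastNear (hpos p.2.1)) p.2.2.2.1 ∩ B p.1 p.2.2.2.2
  have hF : ∀ p, IsClosed (F p) := fun p =>
    hμ.isClosed_stratum_inter (hC _ _) (hi _ _) (hB _ _)
      ((subset_iUnion (B p.1) p.2.2.2.2).trans (hBU p.1).le)
  obtain ⟨e, he⟩ := exists_surjective_nat (ℕ × ℕ × ℕ × ℕ × ℕ)
  refine hPad.countable_closed_union Y (F ∘ e) (fun t => hF _)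
    (fun t => hμ.property_stratum_inter (hi _ _) (hF _) hPad (hPad.pi_fin_succ hP hX _)) ?_
  refine (he.iUnion_comp F).trans (eq_univ_of_forall fun y => ?_)
  obtain ⟨n, hn⟩ : ∃ n, (μ y).support.card = n + 1 :=
    Nat.exists_eq_add_one.2 (hμ.support_nonempty y).card_pos
  obtain ⟨x, hx, hxs⟩ := exists_enumeration (μ y).support
  obtain ⟨δ, hδ, hsep⟩ := exists_pos_separation hx
  -- Two support points with a common label would be closer than 2/(m+1) < δ.
  obtain ⟨m, hm⟩ := exists_nat_one_div_lt (half_pos hδ)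
  -- The distance to the label is strictly below 1/(m+1), leaving room for 1/(k+1).
  have hk : ∀ᶠ k : ℕ in atTop, ∀ j, x j ∈ C m k := eventually_all.2 fun j => by
    have := (tendsto_one_div_add_atTop_nhds_zero_nat (𝕜 := ℝ)).eventually_lt_const
      (sub_pos.2 (dist_leastNear_lt (hpos m) (x j)))
    filter_upwards [this] with k hk
    simp only [C, mem_ofPred_eq]
    linarith
  obtain ⟨k, hk⟩ := hk.exists
  obtain ⟨K, hK⟩ : ∃ K : ℕ, ∀ z, |μ y z| ≤ K := by
    have : ∀ᶠ K : ℕ in atTop, ∀ j, |μ y (x j)| ≤ K := eventually_all.2 fun j =>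
      tendsto_natCast_atTop_atTop.eventually_ge_atTop _
    obtain ⟨K, hK⟩ := this.exists
    refine ⟨K, fun z => ?_⟩
    by_cases hz : z ∈ (μ y).support
    · obtain ⟨j, rfl⟩ := hxs.ge hz
      exact hK j
    · simp [Finsupp.notMem_support_iff.1 hz]
  obtain ⟨b, hb⟩ : ∃ b, y ∈ B n b := mem_iUnion.1 ((hBU n).ge hn.ge)
  refine mem_iUnion.2 ⟨(n, m, k, K, b), ⟨hn, ?_, ?_, hK⟩, hb⟩
  · rw [← hxs]
    exact range_subset_iff.2 hk
  · rw [← hxs]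
    rintro _ ⟨a, rfl⟩ _ ⟨b, rfl⟩ hab
    by_contra hne
    have h1 := hsep a b fun h => hne (h ▸ rfl)
    have h2 := dist_leastNear_lt (hpos m) (x a)
    have h3 := dist_leastNear_lt (hpos m) (x b)
    rw [← hab] at h3
    linarith [dist_triangle_right (x a) (x b) (leastNear (hpos m) (x a))]

end IsSurjectiveDual

theorem theorem1p5 (X Y : Type u) [TopologicalSpace X] [TopologicalSpace Y]
    [TopologicalSpace.MetrizableSpace X] [T6Space Y]
    (hT : (∃ T : Cp X →L[ℝ] Cp Y, Function.Surjective T) ∨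
      (∃ T : CpStar X →L[ℝ] CpStar Y, Function.Surjective T))
    (P : ∀ (Z : Type u) [TopologicalSpace Z], Prop)
    (hP : IsTopologicalProperty P) (hPad : IsAdmissibleProperty P) (hX : P X) :
    P Y := by
  obtain ⟨μ, hμ⟩ : ∃ μ : Y → X →₀ ℝ, IsSurjectiveDual μ := by
    rcases hT with ⟨T, hT⟩ | ⟨T, hT⟩
    · exact exists_isSurjectiveDual (D := Cp X) (E := Cp Y) (fun _ h => h) (fun _ h => h) (fun _ h _ => h)
        (fun _ h _ => h) T hT
    · exact exists_isSurjectiveDual (D := CpStar X) (E := CpStar Y) (fun _ h => h.1) (fun _ h => h.1) (fun _ h hb => ⟨h, hb⟩)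
        (fun _ h hb => ⟨h, hb⟩) T hT
  let _ : MetricSpace X := metrizableSpaceMetric X
  exact hμ.property_of_property hP hPad hX
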